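/- Let $\Bbbk$ be a field and let $P=[1,n]=\{1,\dots,n\}$ ($n\ge 0$) be a finite poset whose order $\le_P$ is compatible with the usual order, i.e. $i<_P j$ implies $i<j$ (equivalently, $P$ is any finite poset with $n$ elements identified with $[1,n]$ through such a labelling). Let $L(P)$ be the lattice of poset ideals (down-closed subsets) of $P$, ordered by inclusion, let $S_{L(P)}=\Bbbk[x_\alpha:\alpha\in L(P)]$, let $I_{L(P)}$ be the ideal generated by the binomials $x_\alpha x_\beta-x_{\alpha\cap\beta}x_{\alpha\cup\beta}$ for incomparable $\alpha,\beta\in L(P)$, and let $\Bbbk[P]=S_{L(P)}/I_{L(P)}$ be the Hibi ring of $P$. Let $C=\{c_1<_P\cdots<_Pc_\ell\}$ be a (possibly empty) chain of $P$, put $C_i=\{c_1,\dots,c_i\}$ for $0\le i\le\ell$ (so $C_0=\emptyset$) and $\mathfrak p(C)=\{C_0,\dots,C_\ell\}$, and let $f:\mathfrak p(C)\to[0,m]=\{0,\dots,m\}$ be a map, $m\ge0$. For $\alpha\in L(P)$ one has $\alpha\cap C\in\mathfrak p(C)$; grade $S_{L(P)}$ by $\mathbb Z^{m+1}$ via $\deg_{f_C}(x_\alpha)=\mathbf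 e_{f(\alpha\cap C)}$, where $\mathbf e_0,\dots,\mathbf e_m$ are the unit vectors. Let $e(P)$ be the set of permutations $\pi=(p_1,\dots,p_n)$ of $[1,n]$ such that $i<j$ whenever $p_i<_Pp_j$. For $\pi\in e(P)$ and $i\in[1,n]$ let $d_i(\pi)=|\{j\in[i,n]:p_j>p_{j+1}\}|$ with $p_{n+1}:=n+1$, and let $d_{n+1}(\pi):=0$ and $d_0(\pi):=d_1(\pi)$. For $1\le j\le\ell$ let $\operatorname{ind}(\pi,c_j)$ be the position of $c_j$ in $\pi$, i.e. $c_j=p_{\operatorname{ind}(\pi,c_j)}$, and let $\operatorname{ind}(\pi,c_0):=0$ and $\operatorname{ind}(\pi,c_{\ell+1}):=n+1$. Then the ideal $I_{L(P)}$ is homogeneous for $\deg_{f_C}$, every graded piece $\Bbbk[P]_{\mathbf a}$ is finite-dimensional, and the multigraded Hilbert series $\mathrm{HS}(\Bbbk[P];\mathbf t)=\sum_{\mathbf a\in\mathbb Z_{\ge0}^{m+1}}\dim_\Bbbk\Bbbk[P]_{\mathbf a}\,\mathbf t^{\mathbf a}$ is, as a formal power series in $t_0,\dots,t_m$, \[ \mathrm{HS}(\Bbbk[P];\mathbf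 t)=\sum_{\pi\in e(P)}\ \prod_{i=0}^{\ell}\frac{t_{f(C_i)}^{\,d_{\operatorname{ind}(\pi,c_i)}(\pi)-d_{\operatorname{ind}(\pi,c_{i+1})}(\pi)}}{(1-t_{f(C_i)})^{\operatorname{ind}(\pi,c_{i+1})-\operatorname{ind}(\pi,c_i)}}. \] In particular, for $m=0$ (for every $C$ and $f$), and likewise for the standard $\mathbb Z$-grading $\deg x_\alpha=1$ for all $\alpha$, the Hilbert series in the one variable $t$ is given by Hibi's formula \[ \mathrm{HS}(\Bbbk[P];t)=\frac{\sum_{\pi\in e(P)}t^{\,d_1(\pi)}}{(1-t)^{n+1}}, \] where $d_1(\pi)$ is the number of descents of $\pi$. -/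

import Mathlib

namespace Hibi

noncomputable section

/-! ### Hibi rings -/

/-- The ideal `I_L` of the polynomial ring `S_L = k[x_α : α ∈ L]` over a lattice `L`, generated by
the binomials `x_α x_β - x_{α ∧ β} x_{α ∨ β}` for incomparable `α, β ∈ L`.

For a poset `P` the distributive lattice `L(P)` of poset ideals is `LowerSet P`: it is ordered by
inclusion, `⊓` is intersection and `⊔` is union. The Hibi ring `k[P]` is `S_{L(P)} / I_{L(P)}`, that
is, `MvPolynomial (LowerSet P) k ⧸ hibiIdeal k (LowerSet P)`. -/
def hibiIdeal (k L : Type*) [Field k] [Lattice L] : Ideal (MvPolynomial L k) :=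
  Ideal.span {g | ∃ α β : L, ¬ α ≤ β ∧ ¬ β ≤ α ∧
    g = MvPolynomial.X α * MvPolynomial.X β -
      MvPolynomial.X (α ⊓ β) * MvPolynomial.X (α ⊔ β)}

/-! ### Multigraded Hilbert series -/

/-- Let `S = k[x_s : s ∈ σ]` be graded by `deg x_s = w s`. For an ideal `I` of `S`, this is the
degree-`a` piece `(S/I)_a` of `S/I`, the image of `S_a` (so that `(S/I)_a = S_a / (I ∩ S_a)`). -/
def gradedPiece {k σ M : Type*} [Field k] [AddCommMonoid M] (w : σ → M)
    (I : Ideal (MvPolynomial σ k)) (a : M) : Submodule k (MvPolynomial σ k ⧸ I) :=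
  (MvPolynomial.weightedHomogeneousSubmodule k w a).map (Ideal.Quotient.mkₐ k I).toLinearMap

/-- The multigraded Hilbert series `∑_a dim_k (S/I)_a t^a` of `S/I`, where `S` is graded by
`deg x_s = w s` and `a` runs over the exponent vectors in the variables `t_i`, `i ∈ τ`.
(All degrees of `S` are vectors of nonnegative integers.) -/
def hilbertSeries {k σ τ : Type*} [Field k] (w : σ → (τ →₀ ℕ))
    (I : Ideal (MvPolynomial σ k)) : MvPowerSeries τ ℚ :=
  fun a => (Module.finrank k (gradedPiece w I a) : ℚ)

/-! ### Multigradings from a chain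

A chain `C = {c_1 < ⋯ < c_ℓ}` of `P` is given by its increasing enumeration `c : Fin ℓ ↪o P`;
thus `c_j` is `c (j - 1)`. -/

section Chain

variable {P : Type*} [PartialOrder P] {ℓ : ℕ}

/-- The initial part `C_i = {c_1, …, c_i}` of the chain, `0 ≤ i ≤ ℓ`. -/
def seg (c : Fin ℓ ↪o P) (i : Fin (ℓ + 1)) : Set P :=
  c '' {j : Fin ℓ | (j : ℕ) < (i : ℕ)}

/-- The set `𝔭(C) = {C_0, C_1, …, C_ℓ}`. -/
def segs (c : Fin ℓ ↪o P) : Set (Set P) :=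
  Set.range (seg c)

/-- For a poset ideal `α` of `P`, the set `α ∩ C` belongs to `𝔭(C)`. -/
theorem inter_mem_segs (c : Fin ℓ ↪o P) (α : LowerSet P) :
    (α : Set P) ∩ Set.range c ∈ segs c := by
  classical
  have hex : ∃ i : ℕ, ∀ h : i < ℓ, c ⟨i, h⟩ ∉ α := ⟨ℓ, fun h => absurd h (lt_irrefl ℓ)⟩
  have hle : Nat.find hex ≤ ℓ := Nat.find_min' hex fun h => absurd h (lt_irrefl ℓ)
  refine ⟨⟨Nat.find hex, Nat.lt_succ_of_le hle⟩, ?_⟩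
  ext x
  constructor
  · rintro ⟨j, hj, rfl⟩
    refine ⟨?_, j, rfl⟩
    have h := Nat.find_min hex (m := (j : ℕ)) hj
    push Not at h
    exact h.2
  · rintro ⟨hx, j, rfl⟩
    refine ⟨j, ?_, rfl⟩
    by_contra hj
    have hj' : Nat.find hex ≤ (j : ℕ) := not_lt.mp hj
    have hlt : Nat.find hex < ℓ := lt_of_le_of_lt hj' j.isLt
    exact Nat.find_spec hex hlt (α.lower (c.monotone (show (⟨_, hlt⟩ : Fin ℓ) ≤ j from hj')) hx)

/-- The standard multigrading `deg x_α = e_{f(α ∩ C)}` on `S_{L(P)}` attached to a map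
`f : 𝔭(C) → [0, m]`. -/
def chainDeg {m : ℕ} (c : Fin ℓ ↪o P) (f : segs c → Fin (m + 1)) (α : LowerSet P) :
    Fin (m + 1) →₀ ℕ :=
  Finsupp.single (f ⟨(α : Set P) ∩ Set.range c, inter_mem_segs c α⟩) 1

end Chain

/-! ### Linear extensions and descents

The poset `P` is identified with `[1, n]` by a bijection `ω : P ≃ Fin n`; the element `a` of `P`
has the label `ω a + 1`. A permutation `π = (p_1, …, p_n)` of `[1, n]` is a
`π : Equiv.Perm (Fin n)`, where `p_j` is `π (j - 1) + 1`. -/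

section Words

variable {P : Type*} [PartialOrder P] {n ℓ : ℕ}

open Classical in
/-- The Jordan-Hölder set `e(P)`: the permutations with `i < j` whenever `p_i <_P p_j`. -/
def jordanHolder (ω : P ≃ Fin n) : Finset (Equiv.Perm (Fin n)) :=
  Finset.univ.filter fun π => ∀ i j : Fin n, ω.symm (π i) < ω.symm (π j) → i < j

open Classical in
/-- `d_i(π) = |{j ∈ [i, n] : p_j > p_{j+1}}|`, where `p_{n+1} = n + 1` (so `j = n` never counts).
The bound variable `j` below stands for the position `j + 1` of the word. In particular
`d_0(π) = d_1(π)` and `d_{n+1}(π) = 0`. -/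
def desFrom (π : Equiv.Perm (Fin n)) (i : ℕ) : ℕ :=
  (Finset.univ.filter fun j : Fin n =>
    i ≤ (j : ℕ) + 1 ∧ ∃ h : (j : ℕ) + 1 < n, π ⟨(j : ℕ) + 1, h⟩ < π j).card

/-- `ind(π, c_i)` for `0 ≤ i ≤ ℓ + 1`: the position of `c_i` in the word `π` if `1 ≤ i ≤ ℓ`, with
the conventions `ind(π, c_0) = 0` and `ind(π, c_{ℓ+1}) = n + 1`. -/
def ind (ω : P ≃ Fin n) (c : Fin ℓ ↪o P) (π : Equiv.Perm (Fin n)) : ℕ → ℕ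
  | 0 => 0
  | i + 1 => if h : i < ℓ then (π.symm (ω (c ⟨i, h⟩)) : ℕ) + 1 else n + 1

end Words

end

end Hibi

namespace Hibi

open MvPolynomial

variable {k P M : Type*} [Field k] [PartialOrder P] [AddCommMonoid M]

/-- A monomial of `S_L` is standard if the variables dividing it form a chain. -/
def IsStandard {L : Type*} [LE L] (u : L →₀ ℕ) : Prop :=
  IsChain (· ≤ ·) (u.support : Set L)

/-- A weight on a lattice for which the Hibi relations are homogeneous. -/
def IsModular {L : Type*} [Lattice L] (w : L → M) : Prop :=
  ∀ α β, w α + w β = w (α ⊓ β) + w (α ⊔ β)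

theorem X_mul_X_sub_mem_weightedHomogeneousSubmodule {L : Type*} [Lattice L] {w : L → M}
    (hw : IsModular w) (α β : L) :
    (X α * X β - X (α ⊓ β) * X (α ⊔ β) : MvPolynomial L k) ∈
      weightedHomogeneousSubmodule k w (w α + w β) := by
  refine Submodule.sub_mem _ ?_ ?_
  · exact (isWeightedHomogeneous_X k w α).mul (isWeightedHomogeneous_X k w β)
  · rw [hw α β]
    exact (isWeightedHomogeneous_X k w _).mul (isWeightedHomogeneous_X k w _)

theorem weightedHomogeneousComponent_mem_hibiIdeal {L : Type*} [Lattice L] {w : L → M}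
    (hw : IsModular w) {p : MvPolynomial L k} (hp : p ∈ hibiIdeal k L) (a : M) :
    weightedHomogeneousComponent w a p ∈ hibiIdeal k L := by
  classical
  let := weightedGradedAlgebra k w
  refine weightedHomogeneousComponent_mem_of_mem k w (I := hibiIdeal k L) ?_ hp a
  refine Ideal.homogeneous_span _ _ ?_
  rintro _ ⟨α, β, -, -, rfl⟩
  exact ⟨_, X_mul_X_sub_mem_weightedHomogeneousSubmodule hw α β⟩

theorem IsModular.finsuppWeight_eq {L : Type*} [Lattice L] {w : L → M} (hw : IsModular w)
    (v : L →₀ ℕ) (α β : L) :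
    Finsupp.weight w (v + (Finsupp.single α 1 + Finsupp.single β 1)) =
      Finsupp.weight w (v + (Finsupp.single (α ⊓ β) 1 + Finsupp.single (α ⊔ β) 1)) := by
  simp only [map_add, Finsupp.weight_single, one_smul, hw α β]

theorem isModular_ncard [Finite P] :
    IsModular (fun α : LowerSet P => (α : Set P).ncard) := fun α β => by
  have := Set.ncard_union_add_ncard_inter (α : Set P) β
  simp only [LowerSet.coe_inf, LowerSet.coe_sup]
  omega

theorem ncard_mul_lt [Finite P] {α β : LowerSet P} (h₁ : ¬ α ≤ β) (h₂ : ¬ β ≤ α) :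
    ((α ⊓ β : LowerSet P) : Set P).ncard * ((α ⊓ β : LowerSet P) : Set P)ᶜ.ncard +
      ((α ⊔ β : LowerSet P) : Set P).ncard * ((α ⊔ β : LowerSet P) : Set P)ᶜ.ncard <
    (α : Set P).ncard * (α : Set P)ᶜ.ncard + (β : Set P).ncard * (β : Set P)ᶜ.ncard := by
  have hm := isModular_ncard α β
  have e (γ : LowerSet P) := Set.ncard_add_ncard_compl (γ : Set P)
  have e₁ := e α
  have e₂ := e β
  have e₃ := e (α ⊓ β)
  have e₄ := e (α ⊔ β)
  have l₁ : ((α ⊓ β : LowerSet P) : Set P).ncard < (α : Set P).ncard :=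
    Set.ncard_lt_ncard (show ((α ⊓ β : LowerSet P) : Set P) ⊂ α from
      LowerSet.coe_ssubset_coe.2 (inf_lt_left.2 h₁))
  have l₂ : ((α ⊓ β : LowerSet P) : Set P).ncard < (β : Set P).ncard :=
    Set.ncard_lt_ncard (show ((α ⊓ β : LowerSet P) : Set P) ⊂ β from
      LowerSet.coe_ssubset_coe.2 (inf_lt_right.2 h₂))
  simp only at hm
  generalize ((α ⊓ β : LowerSet P) : Set P).ncard = c at *
  generalize ((α ⊓ β : LowerSet P) : Set P)ᶜ.ncard = c' at *
  generalize ((α ⊔ β : LowerSet P) : Set P).ncard = d at *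
  generalize ((α ⊔ β : LowerSet P) : Set P)ᶜ.ncard = d' at *
  generalize (α : Set P).ncard = a at *
  generalize (α : Set P)ᶜ.ncard = a' at *
  generalize (β : Set P).ncard = b at *
  generalize (β : Set P)ᶜ.ncard = b' at *
  generalize Nat.card P = N at *
  obtain ⟨x, rfl⟩ := Nat.exists_eq_add_of_lt l₁
  obtain ⟨y, rfl⟩ := Nat.exists_eq_add_of_lt l₂
  obtain rfl : d = c + x + 1 + (y + 1) := by omega
  obtain rfl : a' = d' + (y + 1) := by omega
  obtain rfl : b' = d' + (x + 1) := by omega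
  obtain rfl : c' = d' + (x + 1) + (y + 1) := by omega
  nlinarith

/-- Straightening: every monomial is congruent to a standard one of the same weight. -/
theorem exists_isStandard_sub_mem [Finite P] {w : LowerSet P → M} (hw : IsModular w)
    (u : LowerSet P →₀ ℕ) :
    ∃ v : LowerSet P →₀ ℕ, IsStandard v ∧ Finsupp.weight w v = Finsupp.weight w u ∧
      (monomial u 1 - monomial v 1 : MvPolynomial (LowerSet P) k) ∈
        hibiIdeal k (LowerSet P) := by
  induction hN : Finsupp.weight (fun α : LowerSet P => (α : Set P).ncard * (α : Set P)ᶜ.ncard) u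
    using Nat.strong_induction_on generalizing u with
  | _ N ih =>
    by_cases hu : IsStandard u
    · exact ⟨u, hu, rfl, by simp⟩
    simp only [IsStandard, IsChain, Set.Pairwise, not_forall, not_or] at hu
    obtain ⟨α, hα, β, hβ, hne, h₁, h₂⟩ := hu
    obtain ⟨v, rfl⟩ : ∃ v, u = v + (Finsupp.single α 1 + Finsupp.single β 1) := by
      refine ⟨u - (Finsupp.single α 1 + Finsupp.single β 1), (tsub_add_cancel_of_le ?_).symm⟩
      intro γ
      have hα' : u α ≠ 0 := Finsupp.mem_support_iff.1 hα
      have hβ' : u β ≠ 0 := Finsupp.mem_support_iff.1 hβ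
      classical
      simp only [Finsupp.add_apply, Finsupp.single_apply]
      split_ifs with e₁ e₂ e₂
      · exact absurd (e₁.trans e₂.symm) hne
      · subst e₁; omega
      · subst e₂; omega
      · omega
    obtain ⟨v', hs, hv', hmem⟩ := ih _ (by
      rw [← hN]
      simpa only [map_add, Finsupp.weight_single, one_smul, add_lt_add_iff_left] using
        ncard_mul_lt h₁ h₂) (v + (Finsupp.single (α ⊓ β) 1 + Finsupp.single (α ⊔ β) 1)) rfl
    refine ⟨v', hs, hv'.trans (hw.finsuppWeight_eq v α β).symm, ?_⟩
    have key : (monomial (v + (Finsupp.single α 1 + Finsupp.single β 1)) 1 -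
        monomial (v + (Finsupp.single (α ⊓ β) 1 + Finsupp.single (α ⊔ β) 1)) 1 :
          MvPolynomial (LowerSet P) k) ∈ hibiIdeal k (LowerSet P) := by
      have e (γ δ : LowerSet P) : (monomial (v + (Finsupp.single γ 1 + Finsupp.single δ 1)) 1 :
          MvPolynomial (LowerSet P) k) = monomial v 1 * (X γ * X δ) := by
        simp only [X, monomial_mul, mul_one]
      rw [e, e, ← mul_sub]
      exact Ideal.mul_mem_left _ _ (Ideal.subset_span ⟨α, β, h₁, h₂, rfl⟩)
    simpa using add_mem key hmem

/-- The algebra map `x_α ↦ t^{w α}` to the monoid algebra of the value monoid of `w`. -/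
noncomputable def weightAlgHom (k : Type*) [Field k] {L : Type*} (w : L → M) :
    MvPolynomial L k →ₐ[k] AddMonoidAlgebra k M :=
  aeval fun α => AddMonoidAlgebra.single (w α) 1

theorem weightAlgHom_monomial {L : Type*} (w : L → M) (u : L →₀ ℕ) :
    weightAlgHom k w (monomial u 1) = AddMonoidAlgebra.single (Finsupp.weight w u) 1 := by
  induction u using Finsupp.induction_linear with
  | zero => rw [monomial_zero', map_one, map_one, map_zero, AddMonoidAlgebra.one_def]
  | add u v hu hv =>
    rw [← one_mul (1 : k), ← monomial_mul, map_mul, hu, hv, AddMonoidAlgebra.single_mul_single,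
      map_add]
  | single α c =>
    rw [← X_pow_eq_monomial, map_pow, weightAlgHom, aeval_X, AddMonoidAlgebra.single_pow, one_pow,
      Finsupp.weight_single]

theorem weightAlgHom_eq_zero {L : Type*} [Lattice L] {w : L → M} (hw : IsModular w)
    {p : MvPolynomial L k} (hp : p ∈ hibiIdeal k L) : weightAlgHom k w p = 0 := by
  refine (Ideal.span_le (I := RingHom.ker (weightAlgHom k w))).2 ?_ hp
  rintro _ ⟨α, β, -, -, rfl⟩
  simp [weightAlgHom, RingHom.mem_ker, AddMonoidAlgebra.single_mul_single, hw α β]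

theorem linearIndependent_mk_monomial {L ι : Type*} [Lattice L] {w : L → M} (hw : IsModular w)
    (u : ι → L →₀ ℕ) (hu : Function.Injective fun i => Finsupp.weight w (u i)) :
    LinearIndependent k fun i => Ideal.Quotient.mkₐ k (hibiIdeal k L) (monomial (u i) 1) := by
  have h : LinearIndependent k fun i => weightAlgHom k w (monomial (u i) 1) := by
    simp only [weightAlgHom_monomial]
    exact (AddMonoidAlgebra.basis M k).linearIndependent.comp _ hu
  exact LinearIndependent.of_comp
    (Ideal.Quotient.liftₐ (hibiIdeal k L) (weightAlgHom k w)
      fun _ => weightAlgHom_eq_zero hw).toLinearMap h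

theorem gradedPiece_eq_span [Finite P] {w : LowerSet P → M} (hw : IsModular w) (a : M) :
    gradedPiece w (hibiIdeal k (LowerSet P)) a =
      Submodule.span k (Set.range fun u : {u : LowerSet P →₀ ℕ //
        IsStandard u ∧ Finsupp.weight w u = a} =>
          Ideal.Quotient.mkₐ k (hibiIdeal k (LowerSet P)) (monomial u.1 1)) := by
  rw [gradedPiece, weightedHomogeneousSubmodule_eq_finsupp_supported]
  refine (congrArg _ (AddMonoidAlgebra.supported_eq_span_single _ _)).trans ?_
  refine (Submodule.map_span _ _).trans (le_antisymm ?_ ?_)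
  · rw [Submodule.span_le]
    rintro _ ⟨_, ⟨u, hu, rfl⟩, rfl⟩
    obtain ⟨v, hv, hvw, hmem⟩ := exists_isStandard_sub_mem (k := k) hw u
    refine Submodule.subset_span ⟨⟨v, hv, hvw.trans hu⟩, ?_⟩
    exact (Ideal.Quotient.eq.2 hmem).symm
  · rw [Submodule.span_le]
    rintro _ ⟨u, rfl⟩
    exact Submodule.subset_span ⟨monomial u.1 1, ⟨u.1, u.2.2, rfl⟩, rfl⟩

theorem finite_setOf_weight_single_eq {L τ : Type*} [Finite L] (φ : L → τ) (a : τ →₀ ℕ) :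
    {u : L →₀ ℕ | Finsupp.weight (fun α => Finsupp.single (φ α) 1) u = a}.Finite := by
  have hdeg (u : L →₀ ℕ) :
      (Finsupp.weight (fun α => Finsupp.single (φ α) 1) u).degree = u.degree := by
    induction u using Finsupp.induction_linear with
    | zero => simp
    | add u v hu hv => rw [map_add, map_add, map_add, hu, hv]
    | single α c => simp [Finsupp.weight_single]
  refine (Finsupp.finite_of_degree_le a.degree).subset ?_
  rintro u rfl
  exact (hdeg u).ge

theorem finrank_gradedPiece [Finite P] {w : LowerSet P → M} (hw : IsModular w)
    {M' : Type*} [AddCommMonoid M'] {e : LowerSet P → M'} (he : IsModular e)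
    (hinj : Set.InjOn (Finsupp.weight e) {u : LowerSet P →₀ ℕ | IsStandard u}) (a : M)
    (hfin : {u : LowerSet P →₀ ℕ | Finsupp.weight w u = a}.Finite) :
    Module.Finite k (gradedPiece w (hibiIdeal k (LowerSet P)) a) ∧
    Module.finrank k (gradedPiece w (hibiIdeal k (LowerSet P)) a) =
      {u : LowerSet P →₀ ℕ | IsStandard u ∧ Finsupp.weight w u = a}.ncard := by
  have : Finite {u : LowerSet P →₀ ℕ // IsStandard u ∧ Finsupp.weight w u = a} :=
    (hfin.subset fun (u : LowerSet P →₀ ℕ)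
      (h : IsStandard u ∧ Finsupp.weight w u = a) => h.2).to_subtype
  have := Fintype.ofFinite {u : LowerSet P →₀ ℕ // IsStandard u ∧ Finsupp.weight w u = a}
  rw [gradedPiece_eq_span hw]
  refine ⟨Module.Finite.span_of_finite k (Set.finite_range _), ?_⟩
  refine (finrank_span_eq_card ?_).trans (Nat.card_eq_fintype_card.symm.trans (Nat.card_coe_set_eq _))
  exact linearIndependent_mk_monomial he _ fun u v h =>
    Subtype.ext (hinj u.2.1 v.2.1 h)

end Hibi

namespace Hibi

variable {P : Type*} [PartialOrder P] {n : ℕ}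

/-- The exponent of the toric parametrization `x_α ↦ s ∏_{p ∈ α} t_p` of the Hibi ring. -/
noncomputable def toricWeight (α : LowerSet P) : (P → ℕ) × ℕ :=
  (Set.indicator (α : Set P) 1, 1)

theorem isModular_toricWeight : IsModular (toricWeight (P := P)) := fun α β => by
  classical
  refine Prod.ext (funext fun p => ?_) rfl
  simp only [toricWeight, Prod.fst_add, Pi.add_apply, Set.indicator_apply, SetLike.mem_coe,
    LowerSet.mem_inf_iff, LowerSet.mem_sup_iff, Pi.one_apply]
  by_cases h₁ : p ∈ α <;> by_cases h₂ : p ∈ β <;> simp [h₁, h₂]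

/-- The `P`-partition of a monomial `u`: the number of factors `x_α` of `u` with `p ∈ α`. -/
noncomputable def profile (u : LowerSet P →₀ ℕ) (p : P) : ℕ :=
  (Finsupp.weight toricWeight u).1 p

open Classical in
theorem profile_eq_sum (u : LowerSet P →₀ ℕ) (p : P) :
    profile u p = ∑ α ∈ u.support, if p ∈ α then u α else 0 := by
  simp [profile, Finsupp.weight_apply, Finsupp.sum, Prod.fst_sum, Finset.sum_apply, toricWeight,
    Set.indicator_apply]

theorem profile_le {u : LowerSet P →₀ ℕ} {p q : P}
    (h : ∀ α ∈ u.support, p ∈ α → q ∈ α) : profile u p ≤ profile u q := by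
  classical
  rw [profile_eq_sum, profile_eq_sum]
  refine Finset.sum_le_sum fun α hα => ?_
  by_cases hp : p ∈ α
  · simp [hp, h α hα hp]
  · simp [hp]

theorem profile_lt {u : LowerSet P →₀ ℕ} {p q : P} (h : ∀ α ∈ u.support, p ∈ α → q ∈ α)
    {β : LowerSet P} (hβ : β ∈ u.support) (hp : p ∉ β) (hq : q ∈ β) :
    profile u p < profile u q := by
  classical
  rw [profile_eq_sum, profile_eq_sum]
  refine Finset.sum_lt_sum (fun α hα => ?_) ⟨β, hβ, ?_⟩
  · by_cases hp : p ∈ α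
    · simp [hp, h α hα hp]
    · simp [hp]
  · simpa [hp, hq] using Nat.pos_of_ne_zero (Finsupp.mem_support_iff.1 hβ)

/-- The ideal `{p_1, …, p_j}` of the first `j` letters of a linear extension. -/
def prefixIdeal (ω : P ≃ Fin n) (π : Equiv.Perm (Fin n)) (j : ℕ) : LowerSet P :=
  lowerClosure {p | (π.symm (ω p) : ℕ) < j}

theorem mem_jordanHolder {ω : P ≃ Fin n} {π : Equiv.Perm (Fin n)} :
    π ∈ jordanHolder ω ↔ ∀ i j, ω.symm (π i) < ω.symm (π j) → i < j := by
  simp [jordanHolder]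

theorem mem_prefixIdeal {ω : P ≃ Fin n} {π : Equiv.Perm (Fin n)} (hπ : π ∈ jordanHolder ω)
    {j : ℕ} {p : P} : p ∈ prefixIdeal ω π j ↔ (π.symm (ω p) : ℕ) < j := by
  refine ⟨?_, fun h => subset_lowerClosure h⟩
  rintro ⟨q, hq, hpq⟩
  obtain rfl | hlt := hpq.eq_or_lt
  · exact hq
  · have := mem_jordanHolder.1 hπ (π.symm (ω p)) (π.symm (ω q)) (by simpa using hlt)
    exact (Fin.lt_def.1 this).trans hq

theorem prefixIdeal_mono (ω : P ≃ Fin n) (π : Equiv.Perm (Fin n)) :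
    Monotone (prefixIdeal ω π) := fun _ _ hij =>
  lowerClosure_mono fun _ hp => lt_of_lt_of_le hp hij

theorem prefixIdeal_injOn {ω : P ≃ Fin n} {π : Equiv.Perm (Fin n)} (hπ : π ∈ jordanHolder ω) :
    Function.Injective fun j : Fin (n + 1) => prefixIdeal ω π j := by
  have key (i j : Fin (n + 1)) (hij : i < j) : prefixIdeal ω π i ≠ prefixIdeal ω π j := by
    intro h
    have hi : (i : ℕ) < n := by omega
    have := mem_prefixIdeal (p := ω.symm (π ⟨i, hi⟩)) hπ (j := i)
    rw [h, mem_prefixIdeal hπ] at this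
    simp at this
    omega
  intro i j h
  by_contra hne
  obtain h' | h' := lt_or_gt_of_ne hne
  · exact key i j h' h
  · exact key j i h' h.symm

open Classical in
/-- `1` if the word `π` has a descent at the position `j` (that is, `p_j > p_{j+1}`), else `0`. -/
noncomputable def descentAt (π : Equiv.Perm (Fin n)) (j : ℕ) : ℕ :=
  if ∃ (i : Fin n) (h : (i : ℕ) + 1 < n), (i : ℕ) + 1 = j ∧ π ⟨(i : ℕ) + 1, h⟩ < π i then 1 else 0

/-- The monomial `∏_j x_{p_1, …, p_j}^{h_j}`. -/
noncomputable def chainMonomial (ω : P ≃ Fin n) (π : Equiv.Perm (Fin n)) (h : Fin (n + 1) → ℕ) :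
    LowerSet P →₀ ℕ :=
  ∑ j : Fin (n + 1), Finsupp.single (prefixIdeal ω π j) (h j)

theorem weight_chainMonomial {M : Type*} [AddCommMonoid M] (w : LowerSet P → M) (ω : P ≃ Fin n)
    (π : Equiv.Perm (Fin n)) (h : Fin (n + 1) → ℕ) :
    Finsupp.weight w (chainMonomial ω π h) = ∑ j, h j • w (prefixIdeal ω π j) := by
  simp [chainMonomial, map_sum, Finsupp.weight_single]

/-- `∑_{j ≥ i} h_j`. -/
def tailSum (h : Fin (n + 1) → ℕ) (i : ℕ) : ℕ :=
  ∑ j : Fin (n + 1), if i ≤ j then h j else 0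

theorem tailSum_eq_add (h : Fin (n + 1) → ℕ) (i : Fin (n + 1)) :
    tailSum h i = h i + tailSum h (i + 1) := by
  rw [tailSum, tailSum, ← Fintype.sum_ite_eq i h, ← Finset.sum_add_distrib]
  refine Finset.sum_congr rfl fun j _ => ?_
  simp only [Fin.ext_iff]
  split_ifs <;> omega

theorem tailSum_antitone (h : Fin (n + 1) → ℕ) : Antitone (tailSum h) := fun i j hij => by
  refine Finset.sum_le_sum fun l _ => ?_
  split_ifs <;> omega

theorem profile_chainMonomial {ω : P ≃ Fin n} {π : Equiv.Perm (Fin n)} (hπ : π ∈ jordanHolder ω)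
    (h : Fin (n + 1) → ℕ) (i : Fin n) :
    profile (chainMonomial ω π h) (ω.symm (π i)) = tailSum h (i + 1) := by
  classical
  rw [profile, weight_chainMonomial, tailSum, Prod.fst_sum, Finset.sum_apply]
  have hmem (j : ℕ) : ω.symm (π i) ∈ prefixIdeal ω π j ↔ (i : ℕ) + 1 ≤ j := by
    rw [mem_prefixIdeal hπ, Equiv.apply_symm_apply, Equiv.symm_apply_apply, Nat.lt_iff_add_one_le]
  refine Finset.sum_congr rfl fun j _ => ?_
  simp [toricWeight, Set.indicator_apply, hmem]

theorem isStandard_chainMonomial (ω : P ≃ Fin n) (π : Equiv.Perm (Fin n))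
    (h : Fin (n + 1) → ℕ) : IsStandard (chainMonomial ω π h) := by
  have hsub : ((chainMonomial ω π h).support : Set (LowerSet P)) ⊆
      Set.range (prefixIdeal ω π) := by
    intro α hα
    by_contra hne
    refine Finsupp.mem_support_iff.1 hα ?_
    rw [chainMonomial, Finsupp.finsetSum_apply]
    exact Finset.sum_eq_zero fun j _ => Finsupp.single_eq_of_ne fun e => hne ⟨j, e.symm⟩
  refine IsChain.mono hsub ?_
  rintro _ ⟨i, rfl⟩ _ ⟨j, rfl⟩ -
  exact (le_total i j).imp (fun h => prefixIdeal_mono ω π h) fun h => prefixIdeal_mono ω π h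

theorem chainMonomial_apply {ω : P ≃ Fin n} {π : Equiv.Perm (Fin n)} (hπ : π ∈ jordanHolder ω)
    (h : Fin (n + 1) → ℕ) (j : Fin (n + 1)) : chainMonomial ω π h (prefixIdeal ω π j) = h j := by
  classical
  rw [chainMonomial, Finsupp.finsetSum_apply, Finset.sum_eq_single j]
  · simp
  · exact fun i _ hij => Finsupp.single_eq_of_ne fun e => hij (prefixIdeal_injOn hπ e).symm
  · simp

/-- The linear extension sorting the `P`-partition of `u`, ties being broken by the labels. -/
noncomputable def sortingWord (ω : P ≃ Fin n) (u : LowerSet P →₀ ℕ) : Equiv.Perm (Fin n) :=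
  Tuple.sort fun i => OrderDual.toDual (profile u (ω.symm i))

theorem eq_sortingWord_iff {ω : P ≃ Fin n} {u : LowerSet P →₀ ℕ} {π : Equiv.Perm (Fin n)} :
    π = sortingWord ω u ↔ (∀ i j, i ≤ j → profile u (ω.symm (π j)) ≤ profile u (ω.symm (π i))) ∧
      ∀ i j, i < j → profile u (ω.symm (π i)) = profile u (ω.symm (π j)) → π i < π j :=
  Tuple.eq_sort_iff

theorem sortingWord_mem_jordanHolder {ω : P ≃ Fin n} (hω : StrictMono ω) (u : LowerSet P →₀ ℕ) :
    sortingWord ω u ∈ jordanHolder ω := by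
  obtain ⟨h₁, h₂⟩ := eq_sortingWord_iff.1 (rfl : sortingWord ω u = _)
  refine mem_jordanHolder.2 fun i j hij => ?_
  by_contra hji
  obtain rfl | hji := (not_lt.1 hji).eq_or_lt
  · exact lt_irrefl _ hij
  have hle : profile u (ω.symm (sortingWord ω u j)) ≤ profile u (ω.symm (sortingWord ω u i)) :=
    profile_le fun α _ hα => α.lower hij.le hα
  have := h₂ j i hji (le_antisymm hle (h₁ j i hji.le))
  have h' := hω hij
  simp only [Equiv.apply_symm_apply] at h'
  exact lt_asymm this h'

theorem sortingWord_chainMonomial {ω : P ≃ Fin n} {π : Equiv.Perm (Fin n)}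
    (hπ : π ∈ jordanHolder ω) {h : Fin (n + 1) → ℕ} (hh : ∀ j : Fin (n + 1), descentAt π j ≤ h j) :
    sortingWord ω (chainMonomial ω π h) = π := by
  refine (eq_sortingWord_iff.2 ⟨fun i j hij => ?_, fun i j hij => ?_⟩).symm
  · rw [profile_chainMonomial hπ, profile_chainMonomial hπ]
    exact tailSum_antitone h (by simpa using hij)
  · rw [profile_chainMonomial hπ, profile_chainMonomial hπ]
    obtain ⟨i, hi⟩ := i
    obtain ⟨j, hj⟩ := j
    replace hij : i + 1 ≤ j := hij
    simp only
    induction j, hij using Nat.le_induction with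
    | base =>
      intro he
      have := tailSum_eq_add h ⟨i + 1, by omega⟩
      have h0 : h ⟨i + 1, by omega⟩ = 0 := by simp only at this; omega
      by_contra hlt
      have hne : π ⟨i, hi⟩ ≠ π ⟨i + 1, hj⟩ := fun e => by simpa using π.injective e
      have hd := hh ⟨i + 1, by omega⟩
      rw [h0, descentAt, if_pos ⟨⟨i, hi⟩, hj, rfl, lt_of_le_of_ne (not_lt.1 hlt) hne.symm⟩] at hd
      omega
    | succ j hij ih =>
      intro he
      have a₁ := tailSum_antitone h (show i + 1 ≤ j + 1 by omega)
      have a₂ := tailSum_antitone h (show j + 1 ≤ j + 1 + 1 by omega)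
      refine (ih (by omega) (by omega)).trans ?_
      have := tailSum_eq_add h ⟨j + 1, by omega⟩
      have h0 : h ⟨j + 1, by omega⟩ = 0 := by simp only at this; omega
      by_contra hlt
      have hne : π ⟨j, by omega⟩ ≠ π ⟨j + 1, hj⟩ := fun e => by simpa using π.injective e
      have hd := hh ⟨j + 1, by omega⟩
      rw [h0, descentAt,
        if_pos ⟨⟨j, by omega⟩, hj, rfl, lt_of_le_of_ne (not_lt.1 hlt) hne.symm⟩] at hd
      omega

/-- The members of the support of a standard monomial are prefixes of its sorting word. -/
theorem exists_eq_prefixIdeal {ω : P ≃ Fin n} (hω : StrictMono ω) {u : LowerSet P →₀ ℕ}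
    (hu : IsStandard u) {α : LowerSet P} (hα : α ∈ u.support) :
    ∃ j : Fin (n + 1), α = prefixIdeal ω (sortingWord ω u) j := by
  classical
  have hπ := sortingWord_mem_jordanHolder hω u
  obtain ⟨h₁, -⟩ := eq_sortingWord_iff.1 (rfl : sortingWord ω u = _)
  generalize sortingWord ω u = π at *
  have down (i j : Fin n) (hij : i ≤ j) (hj : ω.symm (π j) ∈ α) : ω.symm (π i) ∈ α := by
    by_contra hi
    refine (h₁ i j hij).not_gt (profile_lt (fun β hβ hiβ => ?_) hα hi hj)
    obtain h | h := hu.total hβ hα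
    · exact absurd (h hiβ) hi
    · exact h hj
  have hex : ∃ j : ℕ, ∀ h : j < n, ω.symm (π ⟨j, h⟩) ∉ α := ⟨n, fun h => absurd h (lt_irrefl n)⟩
  have hle : Nat.find hex ≤ n := Nat.find_min' hex fun h => absurd h (lt_irrefl n)
  refine ⟨⟨Nat.find hex, Nat.lt_succ_of_le hle⟩, ?_⟩
  ext p
  obtain ⟨i, rfl⟩ : ∃ i, p = ω.symm (π i) := ⟨π.symm (ω p), by simp⟩
  simp only [SetLike.mem_coe, mem_prefixIdeal hπ, Equiv.apply_symm_apply, Equiv.symm_apply_apply]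
  constructor
  · intro hi
    by_contra hlt
    have hlt := not_lt.1 hlt
    exact Nat.find_spec hex (hlt.trans_lt i.isLt) (down _ i hlt hi)
  · intro hi
    have := Nat.find_min hex hi
    push Not at this
    exact this.2

theorem eq_chainMonomial {ω : P ≃ Fin n} (hω : StrictMono ω) {u : LowerSet P →₀ ℕ}
    (hu : IsStandard u) :
    u = chainMonomial ω (sortingWord ω u) fun j => u (prefixIdeal ω (sortingWord ω u) j) := by
  have hπ := sortingWord_mem_jordanHolder hω u
  ext α
  by_cases hα : α ∈ u.support
  · obtain ⟨j, rfl⟩ := exists_eq_prefixIdeal hω hu hα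
    rw [chainMonomial_apply hπ]
  · rw [chainMonomial, Finsupp.finsetSum_apply, Finsupp.notMem_support_iff.1 hα]
    refine (Finset.sum_eq_zero fun j _ => ?_).symm
    by_cases e : α = prefixIdeal ω (sortingWord ω u) j
    · rw [← e, Finsupp.notMem_support_iff.1 hα, Finsupp.single_zero, Finsupp.zero_apply]
    · exact Finsupp.single_eq_of_ne e

theorem descentAt_le {ω : P ≃ Fin n} (hω : StrictMono ω) {u : LowerSet P →₀ ℕ}
    (hu : IsStandard u) (j : Fin (n + 1)) :
    descentAt (sortingWord ω u) j ≤ u (prefixIdeal ω (sortingWord ω u) j) := by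
  have hπ := sortingWord_mem_jordanHolder hω u
  have he := eq_chainMonomial hω hu
  obtain ⟨h₁, h₂⟩ := eq_sortingWord_iff.1 (rfl : sortingWord ω u = _)
  generalize sortingWord ω u = π at *
  set h := fun j : Fin (n + 1) => u (prefixIdeal ω π j) with hh
  rw [descentAt]
  split_ifs with hd
  · obtain ⟨i, hi, hij, hlt⟩ := hd
    have hne : profile u (ω.symm (π i)) ≠ profile u (ω.symm (π ⟨i + 1, hi⟩)) := fun e =>
      lt_asymm hlt (h₂ _ _ (Fin.lt_def.2 (Nat.lt_succ_self _)) e)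
    rw [he, profile_chainMonomial hπ, profile_chainMonomial hπ] at hne
    have := tailSum_eq_add h j
    rw [← hij] at this
    simp only at hne
    change 1 ≤ h j
    omega
  · exact Nat.zero_le _

theorem weight_toricWeight_injOn {ω : P ≃ Fin n} (hω : StrictMono ω) :
    Set.InjOn (Finsupp.weight toricWeight) {u : LowerSet P →₀ ℕ | IsStandard u} := by
  intro u hu v hv huv
  have hp : profile u = profile v := congrArg Prod.fst huv
  have hs : sortingWord ω u = sortingWord ω v := by rw [sortingWord, sortingWord, hp]
  have hπ := sortingWord_mem_jordanHolder hω u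
  have eu := eq_chainMonomial hω hu
  have ev := eq_chainMonomial hω hv
  rw [← hs] at ev
  generalize sortingWord ω u = π at *
  generalize (fun j : Fin (n + 1) => u (prefixIdeal ω π j)) = g at eu
  generalize (fun j : Fin (n + 1) => v (prefixIdeal ω π j)) = h at ev
  subst eu ev
  have htail : ∀ i ≤ n + 1, tailSum g i = tailSum h i := by
    intro i hi
    obtain rfl | hi' := hi.eq_or_lt
    · simp [tailSum, Nat.not_le.2 (Fin.isLt _)]
    obtain _ | i := i
    · simpa [weight_chainMonomial, Prod.snd_sum, toricWeight, tailSum] using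
        congrArg Prod.snd huv
    · have := congrFun hp (ω.symm (π ⟨i, by omega⟩))
      rwa [profile_chainMonomial hπ, profile_chainMonomial hπ] at this
  congr 1
  funext j
  have a₁ := tailSum_eq_add g j
  have a₂ := tailSum_eq_add h j
  have a₃ := htail j (by omega)
  have a₄ := htail (j + 1) (by omega)
  omega

theorem ncard_isStandard {M : Type*} [AddCommMonoid M] {ω : P ≃ Fin n} (hω : StrictMono ω)
    (w : LowerSet P → M) (a : M) (hfin : {u : LowerSet P →₀ ℕ | Finsupp.weight w u = a}.Finite) :
    {u : LowerSet P →₀ ℕ | IsStandard u ∧ Finsupp.weight w u = a}.ncard =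
      ∑ π ∈ jordanHolder ω, {h : Fin (n + 1) → ℕ | (∀ j : Fin (n + 1), descentAt π j ≤ h j) ∧
        ∑ j, h j • w (prefixIdeal ω π j) = a}.ncard := by
  classical
  have hS : {u : LowerSet P →₀ ℕ | IsStandard u ∧ Finsupp.weight w u = a}.Finite :=
    hfin.subset fun _ h => h.2
  rw [Set.ncard_eq_toFinset_card _ hS, Finset.card_eq_sum_card_fiberwise
    (f := sortingWord ω) (t := jordanHolder ω) fun u _ => sortingWord_mem_jordanHolder hω u]
  refine Finset.sum_congr rfl fun π hπ => ?_
  rw [← Set.ncard_coe_finset]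
  refine (Set.ncard_congr (fun h _ => chainMonomial ω π h) ?_ ?_ ?_).symm
  · rintro h ⟨h₁, h₂⟩
    simpa [isStandard_chainMonomial, weight_chainMonomial, h₂] using
      sortingWord_chainMonomial hπ h₁
  · intro g h _ _ e
    funext j
    rw [← chainMonomial_apply hπ g, e, chainMonomial_apply hπ]
  · intro u hu
    simp only [Finset.coe_filter, Set.Finite.mem_toFinset, Set.mem_ofPred_eq] at hu
    obtain ⟨⟨hu, ha⟩, rfl⟩ := hu
    have e := eq_chainMonomial hω hu
    refine ⟨_, ⟨descentAt_le hω hu, ?_⟩, e.symm⟩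
    rw [← weight_chainMonomial, ← e, ha]

end Hibi

namespace Hibi

variable {P : Type*} [PartialOrder P] {n : ℕ}

open Classical in
theorem coeff_X_pow_mul_inv_one_sub_X {τ : Type*} (s : τ) (d : ℕ) (b : τ →₀ ℕ) :
    MvPowerSeries.coeff b
      (MvPowerSeries.X s ^ d * (1 - MvPowerSeries.X s)⁻¹ : MvPowerSeries τ ℚ) =
      if ∃ c, d ≤ c ∧ Finsupp.single s c = b then 1 else 0 := by
  set F : MvPowerSeries τ ℚ :=
    fun b => if ∃ c, d ≤ c ∧ Finsupp.single s c = b then 1 else 0 with hF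
  have hcoeff (b) : MvPowerSeries.coeff b F =
      if ∃ c, d ≤ c ∧ Finsupp.single s c = b then 1 else 0 := rfl
  have hc : MvPowerSeries.constantCoeff (1 - MvPowerSeries.X s : MvPowerSeries τ ℚ) ≠ 0 := by
    simp
  rw [← (MvPowerSeries.eq_mul_inv_iff_mul_eq hc).2 (show F * (1 - MvPowerSeries.X s) = _ from ?_),
    hcoeff]
  ext b
  rw [mul_sub, mul_one, map_sub, MvPowerSeries.X, MvPowerSeries.coeff_mul_monomial, hcoeff, hcoeff,
    ← MvPowerSeries.X, MvPowerSeries.coeff_X_pow, mul_one]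
  by_cases hb : ∃ c, Finsupp.single s c = b
  · obtain ⟨c, rfl⟩ := hb
    have hle : Finsupp.single s 1 ≤ Finsupp.single s c ↔ 1 ≤ c := by simp
    simp only [hle, ← Finsupp.single_tsub, (Finsupp.single_injective s).eq_iff, exists_eq_right]
    split_ifs <;> first | omega | norm_num
  · have h₁ : ¬ ∃ c, d ≤ c ∧ Finsupp.single s c = b := fun ⟨c, _, h⟩ => hb ⟨c, h⟩
    have h₂ : b ≠ Finsupp.single s d := fun h => hb ⟨d, h.symm⟩
    rw [if_neg h₁, if_neg h₂]
    split_ifs with h₃ h₄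
    · obtain ⟨c, -, h⟩ := h₄
      refine absurd ⟨c + 1, ?_⟩ hb
      rw [Finsupp.single_add, h, tsub_add_cancel_of_le h₃]
    · simp
    · simp

theorem coeff_prod_X_pow_mul_inv_one_sub_X {ι τ : Type*} [Fintype ι] (s : ι → τ) (d : ι → ℕ)
    (a : τ →₀ ℕ) :
    MvPowerSeries.coeff a
      (∏ j, MvPowerSeries.X (s j) ^ d j * (1 - MvPowerSeries.X (s j))⁻¹ : MvPowerSeries τ ℚ) =
      ({h : ι → ℕ | (∀ j, d j ≤ h j) ∧
        ∑ j, h j • Finsupp.single (s j) 1 = a}.ncard : ℚ) := by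
  classical
  rw [MvPowerSeries.coeff_prod]
  simp only [coeff_X_pow_mul_inv_one_sub_X, Finset.prod_boole]
  refine (Finset.sum_congr rfl fun l _ => by congr).trans ((Finset.sum_boole
    (fun l : ι →₀ τ →₀ ℕ => ∀ i ∈ Finset.univ, ∃ c, d i ≤ c ∧ Finsupp.single (s i) c = l i)
      _).trans ?_)
  rw [← Set.ncard_coe_finset]
  congr 1
  refine (Set.ncard_congr (fun h _ => Finsupp.equivFunOnFinite.symm
    fun j => Finsupp.single (s j) (h j)) ?_ ?_ ?_).symm
  · rintro h ⟨h₁, h₂⟩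
    simp only [Finset.coe_filter, Set.mem_ofPred_eq, Finset.mem_finsuppAntidiag]
    refine ⟨⟨?_, Finset.subset_univ _⟩, fun j _ => ⟨h j, h₁ j, rfl⟩⟩
    rw [← h₂]
    exact Finset.sum_congr rfl fun j _ => by simp
  · intro g h _ _ e
    funext j
    exact Finsupp.single_injective (s j) (DFunLike.congr_fun e j)
  · intro l hl
    simp only [Finset.coe_filter, Set.mem_ofPred_eq, Finset.mem_finsuppAntidiag, Finset.mem_univ,
      true_imp_iff] at hl
    obtain ⟨⟨hsum, -⟩, hl⟩ := hl
    choose h hd hh using hl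
    refine ⟨h, ⟨hd, ?_⟩, Finsupp.ext hh⟩
    rw [← hsum]
    exact Finset.sum_congr rfl fun j _ => by simp [hh]

/-- The Hilbert series of the Hibi ring for a grading by unit vectors, as a sum over linear
extensions of the series of a maximal chain of `L(P)`. -/
theorem hilbertSeries_eq_sum_prod {k τ : Type*} [Field k] {ω : P ≃ Fin n} (hω : StrictMono ω)
    (φ : LowerSet P → τ) (hφ : IsModular fun α => Finsupp.single (φ α) 1) :
    (∀ a, Module.Finite k
      (gradedPiece (fun α => Finsupp.single (φ α) 1) (hibiIdeal k (LowerSet P)) a)) ∧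
    hilbertSeries (fun α => Finsupp.single (φ α) 1) (hibiIdeal k (LowerSet P)) =
      ∑ π ∈ jordanHolder ω, ∏ j : Fin (n + 1),
        MvPowerSeries.X (φ (prefixIdeal ω π j)) ^ descentAt π j *
          (1 - MvPowerSeries.X (φ (prefixIdeal ω π j)))⁻¹ := by
  have := Finite.of_equiv _ ω.symm
  have key (a) := finrank_gradedPiece (k := k) hφ isModular_toricWeight
    (weight_toricWeight_injOn hω) a (finite_setOf_weight_single_eq φ a)
  refine ⟨fun a => (key a).1, ?_⟩
  ext a
  rw [map_sum]
  simp only [coeff_prod_X_pow_mul_inv_one_sub_X]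
  refine (congrArg Nat.cast ((key a).2.trans
    (ncard_isStandard hω _ a (finite_setOf_weight_single_eq φ a)))).trans ?_
  rw [Nat.cast_sum]

theorem desFrom_eq_sum (π : Equiv.Perm (Fin n)) (i : ℕ) :
    desFrom π i = ∑ j ∈ Finset.Ico i (n + 1), descentAt π j := by
  classical
  rw [desFrom]
  simp only [descentAt, Finset.sum_boole, Nat.cast_id]
  refine Finset.card_bij (fun j _ => (j : ℕ) + 1) ?_ ?_ ?_
  · intro j hj
    simp only [Finset.mem_filter, Finset.mem_univ, true_and] at hj
    obtain ⟨h₁, h₂, h₃⟩ := hj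
    simp only [Finset.mem_filter, Finset.mem_Ico]
    exact ⟨by omega, j, h₂, rfl, h₃⟩
  · intro i _ j _ h
    exact Fin.ext (by omega)
  · intro j hj
    simp only [Finset.mem_filter, Finset.mem_Ico] at hj
    obtain ⟨h₁, i, h₂, rfl, h₃⟩ := hj
    exact ⟨i, by simpa using ⟨h₁.1, h₂, h₃⟩, rfl⟩

theorem descentAt_zero (π : Equiv.Perm (Fin n)) : descentAt π 0 = 0 := by
  simp [descentAt]

theorem desFrom_sub_desFrom (π : Equiv.Perm (Fin n)) {i j : ℕ} (hij : i ≤ j) (hj : j ≤ n + 1) :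
    desFrom π i - desFrom π j = ∑ l ∈ Finset.Ico i j, descentAt π l := by
  rw [desFrom_eq_sum, desFrom_eq_sum, ← Finset.sum_Ico_consecutive _ hij hj]
  omega

theorem sum_range_descentAt (π : Equiv.Perm (Fin n)) :
    ∑ j ∈ Finset.range (n + 1), descentAt π j = desFrom π 1 := by
  rw [desFrom_eq_sum, Finset.range_eq_Ico, Finset.sum_eq_sum_Ico_succ_bot (by omega),
    descentAt_zero, zero_add]

theorem inv_pow_mvPowerSeries {τ : Type*} (p : MvPowerSeries τ ℚ) (i : ℕ) :
    (p ^ i)⁻¹ = p⁻¹ ^ i := by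
  induction i with
  | zero => simp
  | succ i ih => rw [pow_succ, MvPowerSeries.mul_inv_rev, ih, pow_succ']

theorem prod_X_pow_mul_inv {τ : Type*} (s : τ) (d : ℕ → ℕ) (S : Finset ℕ) :
    ∏ j ∈ S, (MvPowerSeries.X s ^ d j * (1 - MvPowerSeries.X s)⁻¹ : MvPowerSeries τ ℚ) =
      MvPowerSeries.X s ^ (∑ j ∈ S, d j) * ((1 - MvPowerSeries.X s) ^ S.card)⁻¹ := by
  rw [Finset.prod_mul_distrib, Finset.prod_pow_eq_pow_sum, Finset.prod_const,
    inv_pow_mvPowerSeries]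

theorem hilbertSeries_const {k τ : Type*} [Field k] {ω : P ≃ Fin n} (hω : StrictMono ω) (s : τ) :
    hilbertSeries (fun _ : LowerSet P => Finsupp.single s 1) (hibiIdeal k (LowerSet P)) =
      ∑ π ∈ jordanHolder ω, MvPowerSeries.X s ^ desFrom π 1 *
        ((1 - MvPowerSeries.X s) ^ (n + 1))⁻¹ := by
  rw [(hilbertSeries_eq_sum_prod hω (fun _ => s) fun _ _ => rfl).2]
  refine Finset.sum_congr rfl fun π _ => ?_
  rw [Fin.prod_univ_eq_prod_range (fun j => (MvPowerSeries.X s ^ descentAt π j *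
    (1 - MvPowerSeries.X s)⁻¹ : MvPowerSeries τ ℚ)), prod_X_pow_mul_inv, sum_range_descentAt,
    Finset.card_range]

section Chain

variable {ℓ : ℕ} {ω : P ≃ Fin n} {π : Equiv.Perm (Fin n)}

theorem isModular_chainDeg {m : ℕ} (c : Fin ℓ ↪o P) (f : segs c → Fin (m + 1)) :
    IsModular (chainDeg c f) := by
  intro α β
  have total : (α : Set P) ∩ Set.range c ⊆ β ∨ (β : Set P) ∩ Set.range c ⊆ α := by
    by_contra! h
    obtain ⟨⟨_, ⟨hx, i, rfl⟩, hxβ⟩, ⟨_, ⟨hy, j, rfl⟩, hyα⟩⟩ :=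
      h.imp Set.not_subset.1 Set.not_subset.1
    obtain hij | hij := le_total i j
    · exact hxβ (β.lower (c.monotone hij) hy)
    · exact hyα (α.lower (c.monotone hij) hx)
  have congr {γ δ : LowerSet P} (h : (γ : Set P) ∩ Set.range c = (δ : Set P) ∩ Set.range c) :
      chainDeg c f γ = chainDeg c f δ := by
    simp only [chainDeg, h]
  obtain h | h := total
  · rw [congr (γ := α ⊓ β) (δ := α), congr (γ := α ⊔ β) (δ := β)]
    · ext x; simp only [LowerSet.coe_sup, Set.mem_inter_iff, Set.mem_union]
      exact ⟨fun hx => ⟨hx.1.elim (fun hα => h ⟨hα, hx.2⟩) id, hx.2⟩, fun hx => ⟨.inr hx.1, hx.2⟩⟩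
    · ext x; simp only [LowerSet.coe_inf, Set.mem_inter_iff]
      exact ⟨fun hx => ⟨hx.1.1, hx.2⟩, fun hx => ⟨⟨hx.1, h hx⟩, hx.2⟩⟩
  · rw [add_comm (chainDeg c f α), congr (γ := α ⊓ β) (δ := β), congr (γ := α ⊔ β) (δ := α)]
    · ext x; simp only [LowerSet.coe_sup, Set.mem_inter_iff, Set.mem_union]
      exact ⟨fun hx => ⟨hx.1.elim id (fun hα => h ⟨hα, hx.2⟩), hx.2⟩, fun hx => ⟨.inl hx.1, hx.2⟩⟩
    · ext x; simp only [LowerSet.coe_inf, Set.mem_inter_iff]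
      exact ⟨fun hx => ⟨hx.1.2, hx.2⟩, fun hx => ⟨⟨h hx, hx.1⟩, hx.2⟩⟩

theorem ind_last (c : Fin ℓ ↪o P) : ind ω c π (ℓ + 1) = n + 1 := by
  simp [ind]

theorem ind_succ (c : Fin ℓ ↪o P) (i : Fin ℓ) :
    ind ω c π (i + 1) = (π.symm (ω (c i)) : ℕ) + 1 := by
  simp [ind]

theorem ind_le (c : Fin ℓ ↪o P) (i : ℕ) : ind ω c π i ≤ n + 1 := by
  rcases i with _ | i
  · simp [ind]
  · rw [ind]
    split_ifs <;> omega

theorem ind_monotone (hπ : π ∈ jordanHolder ω) (c : Fin ℓ ↪o P) : Monotone (ind ω c π) := by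
  refine monotone_nat_of_le_succ fun i => ?_
  rcases i with _ | i
  · simp [ind]
  by_cases hi : i + 1 < ℓ
  · rw [ind_succ c ⟨i, by omega⟩, ind_succ c ⟨i + 1, hi⟩]
    have := mem_jordanHolder.1 hπ (π.symm (ω (c ⟨i, by omega⟩))) (π.symm (ω (c ⟨i + 1, hi⟩)))
      (by simp)
    exact Nat.succ_le_succ (Fin.le_def.1 this.le)
  · refine (ind_le c _).trans_eq ?_
    rw [ind, dif_neg hi]

theorem prefixIdeal_inter_range (hπ : π ∈ jordanHolder ω) (c : Fin ℓ ↪o P) (i : Fin (ℓ + 1))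
    {j : ℕ} (h₁ : ind ω c π i ≤ j) (h₂ : j < ind ω c π (i + 1)) :
    (prefixIdeal ω π j : Set P) ∩ Set.range c = seg c i := by
  ext x
  simp only [Set.mem_inter_iff, SetLike.mem_coe, mem_prefixIdeal hπ, seg, Set.mem_image,
    Set.mem_range, Set.mem_ofPred_eq]
  constructor
  · rintro ⟨hx, l, rfl⟩
    refine ⟨l, ?_, rfl⟩
    by_contra hl
    have := ind_monotone hπ c (show (i : ℕ) + 1 ≤ l + 1 by omega)
    rw [ind_succ c l] at this
    omega
  · rintro ⟨l, hl, rfl⟩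
    refine ⟨?_, l, rfl⟩
    have := ind_monotone hπ c (show (l : ℕ) + 1 ≤ i by omega)
    rw [ind_succ c l] at this
    omega

theorem prod_range_prod_Ico {R : Type*} [CommMonoid R] {a : ℕ → ℕ} (ha : Monotone a) (F : ℕ → R)
    (m : ℕ) : ∏ i ∈ Finset.range m, ∏ j ∈ Finset.Ico (a i) (a (i + 1)), F j =
      ∏ j ∈ Finset.Ico (a 0) (a m), F j := by
  induction m with
  | zero => simp
  | succ m ih =>
    rw [Finset.prod_range_succ, ih, Finset.prod_Ico_consecutive _ (ha m.zero_le) (ha m.le_succ)]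

theorem prod_chain_eq {m : ℕ} (hπ : π ∈ jordanHolder ω) (c : Fin ℓ ↪o P)
    (f : segs c → Fin (m + 1)) :
    ∏ j : Fin (n + 1),
      (MvPowerSeries.X (f ⟨_, inter_mem_segs c (prefixIdeal ω π j)⟩) ^ descentAt π j *
        (1 - MvPowerSeries.X (f ⟨_, inter_mem_segs c (prefixIdeal ω π j)⟩))⁻¹ :
          MvPowerSeries (Fin (m + 1)) ℚ) =
    ∏ i : Fin (ℓ + 1),
      (MvPowerSeries.X (f ⟨seg c i, Set.mem_range_self i⟩) ^
          (desFrom π (ind ω c π i) - desFrom π (ind ω c π (i + 1)))) *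
        ((1 - MvPowerSeries.X (f ⟨seg c i, Set.mem_range_self i⟩)) ^
          (ind ω c π (i + 1) - ind ω c π i))⁻¹ := by
  set F : ℕ → MvPowerSeries (Fin (m + 1)) ℚ := fun j =>
    MvPowerSeries.X (f ⟨_, inter_mem_segs c (prefixIdeal ω π j)⟩) ^ descentAt π j *
      (1 - MvPowerSeries.X (f ⟨_, inter_mem_segs c (prefixIdeal ω π j)⟩))⁻¹ with hF
  have hmono := ind_monotone hπ c
  have hprod := prod_range_prod_Ico hmono F (ℓ + 1)
  rw [ind_last, ind, ← Finset.range_eq_Ico, ← Fin.prod_univ_eq_prod_range F,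
    ← Fin.prod_univ_eq_prod_range
      (fun i => ∏ j ∈ Finset.Ico (ind ω c π i) (ind ω c π (i + 1)), F j)] at hprod
  refine hprod.symm.trans (Finset.prod_congr rfl fun i _ => ?_)
  rw [desFrom_sub_desFrom π (hmono (i : ℕ).le_succ) (ind_le c _), ← Nat.card_Ico,
    ← prod_X_pow_mul_inv]
  refine Finset.prod_congr rfl fun j hj => ?_
  rw [Finset.mem_Ico] at hj
  have e := prefixIdeal_inter_range hπ c i hj.1 hj.2
  simp only [hF, e]

end Chain

end Hibi

theorem corollary3p3 {k P : Type*} [Field k] [PartialOrder P] {n : ℕ}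
    (ω : P ≃ Fin n) (hω : StrictMono ω) :
    -- the multigraded Hilbert series for the grading given by a chain and a map `f : 𝔭(C) → [0, m]`
    (∀ (ℓ m : ℕ) (c : Fin ℓ ↪o P) (f : Hibi.segs c → Fin (m + 1)),
      -- `I_{L(P)}` is homogeneous, and the graded pieces of `k[P]` are finite-dimensional
      (∀ p ∈ Hibi.hibiIdeal k (LowerSet P), ∀ a,
        MvPolynomial.weightedHomogeneousComponent (Hibi.chainDeg c f) a p ∈
          Hibi.hibiIdeal k (LowerSet P)) ∧
      (∀ a, Module.Finite k
          (Hibi.gradedPiece (Hibi.chainDeg c f) (Hibi.hibiIdeal k (LowerSet P)) a)) ∧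
      Hibi.hilbertSeries (Hibi.chainDeg c f) (Hibi.hibiIdeal k (LowerSet P)) =
        ∑ π ∈ Hibi.jordanHolder ω, ∏ i : Fin (ℓ + 1),
          (MvPowerSeries.X (f ⟨Hibi.seg c i, Set.mem_range_self i⟩) ^
              (Hibi.desFrom π (Hibi.ind ω c π i) - Hibi.desFrom π (Hibi.ind ω c π (i + 1)))) *
            ((1 - MvPowerSeries.X (f ⟨Hibi.seg c i, Set.mem_range_self i⟩)) ^
              (Hibi.ind ω c π (i + 1) - Hibi.ind ω c π i))⁻¹) ∧
    -- the case `m = 0`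
    (∀ (ℓ : ℕ) (c : Fin ℓ ↪o P) (f : Hibi.segs c → Fin (0 + 1)),
      Hibi.hilbertSeries (Hibi.chainDeg c f) (Hibi.hibiIdeal k (LowerSet P)) =
        ∑ π ∈ Hibi.jordanHolder ω,
          MvPowerSeries.X 0 ^ Hibi.desFrom π 1 * ((1 - MvPowerSeries.X 0) ^ (n + 1))⁻¹) ∧
    -- the ordinary `ℤ`-grading with `deg x_α = 1`, as a power series in one variable
    (Hibi.hilbertSeries (fun _ : LowerSet P => Finsupp.single () 1)
        (Hibi.hibiIdeal k (LowerSet P)) : PowerSeries ℚ) =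
      ∑ π ∈ Hibi.jordanHolder ω,
        PowerSeries.X ^ Hibi.desFrom π 1 * ((1 - PowerSeries.X) ^ (n + 1))⁻¹ := by
  refine ⟨fun ℓ m c f => ⟨fun p hp a => ?_, ?_, ?_⟩, fun ℓ c f => ?_, ?_⟩
  · exact Hibi.weightedHomogeneousComponent_mem_hibiIdeal (Hibi.isModular_chainDeg c f) hp a
  · exact (Hibi.hilbertSeries_eq_sum_prod hω _ (Hibi.isModular_chainDeg c f)).1
  · refine (Hibi.hilbertSeries_eq_sum_prod hω _ (Hibi.isModular_chainDeg c f)).2.trans ?_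
    exact Finset.sum_congr rfl fun π hπ => Hibi.prod_chain_eq hπ c f
  · have h : Hibi.chainDeg c f = fun _ => Finsupp.single 0 1 :=
      funext fun α => congrArg (Finsupp.single · 1) (Fin.ext (by omega))
    rw [h]
    exact Hibi.hilbertSeries_const hω 0
  · exact Hibi.hilbertSeries_const hω ()
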